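/- Let $N\ge 0$ be an integer and let $\mathcal S^4$ be the space of real symmetric $4\times4$ matrices. Let $$\mathcal M_N=\{(qq^T,\;qq^T\cos\omega,\;qq^T\sin\omega,\;\ldots,\;qq^T\cos N\omega,\;qq^T\sin N\omega): q\in\mathbb R^4,\ \|q\|=1,\ \omega\in[-\pi,\pi)\}\subset(\mathcal S^4)^{2N+1}.$$ For $X_0,\ldots,X_N\in\mathcal S^4$ let $\mathrm{Toeplitz}(X_0,\ldots,X_N)$ be the $4(N+1)\times4(N+1)$ matrix made of $4\times 4$ blocks whose block in position $(i,j)$, $0\le i,j\le N$, is $X_{j-i}$ if $i\le j$ and $X_{i-j}^T$ if $i>j$. For $S_1,\ldots,S_{2N+1}\in\mathcal S^4$ let $\mathrm{Hankel}(S_1,\ldots,S_{2N+1})$ be the $4(N+1)\times4(N+1)$ matrix whose $4\times4$ block in position $(i,j)$, $0\le i,j\le N$, is $S_{i+j+1}$. Then the convex hull of $\mathcal M_N$ is $$\mathrm{conv}(\mathcal M_N)=\{(X_0,X_1,Y_1,\ldots,X_N,Y_N)\in(\mathcal S^4)^{2N+1}:\ \mathrm{tr}(X_0)=1,\ \mathrm{Toeplitz}(X_0,X_1,\ldots,X_N)+\mathrm{Hankel}(Y_N,Y_{N-1},\ldots,Y_1,0,-Y_1,\ldots,-Y_{N-1},-Y_N)\succeq0\},$$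 where $\succeq 0$ means positive semidefinite. -/

import Mathlib

namespace TrigMoment

/-- The real vector space of tuples `(X₀, X₁, Y₁, …, X_N, Y_N)` of `2N + 1` real `4 × 4` matrices.
The tuple is stored as `(X, Y)` with `X n = X_n` for `0 ≤ n ≤ N`, and `Y n = Y_{n+1}` for
`0 ≤ n < N`. -/
abbrev Tuple (N : ℕ) : Type :=
  (Fin (N + 1) → Matrix (Fin 4) (Fin 4) ℝ) × (Fin N → Matrix (Fin 4) (Fin 4) ℝ)

/-- The block Toeplitz matrix with first block row `T₀, T₁, …, T_N` and first block column
`T₀, T₁ᵀ, …, T_Nᵀ`. A row or column index `(i, a)` means entry `a` of block `i`. -/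
def blockToeplitz {N d : ℕ} (T : Fin (N + 1) → Matrix (Fin d) (Fin d) ℝ) :
    Matrix (Fin (N + 1) × Fin d) (Fin (N + 1) × Fin d) ℝ :=
  Matrix.of fun p q =>
    if (p.1 : ℕ) ≤ (q.1 : ℕ) then
      T ⟨(q.1 : ℕ) - (p.1 : ℕ), by omega⟩ p.2 q.2
    else
      (T ⟨(p.1 : ℕ) - (q.1 : ℕ), by omega⟩).transpose p.2 q.2

/-- The block Hankel matrix of `S₁, …, S_{2N+1}`, whose block `(i, j)`, counted from `0`, is
`S_{i+j+1}`. Here `S k` stands for `S_{k+1}`. -/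
def blockHankel {N d : ℕ} (S : Fin (2 * N + 1) → Matrix (Fin d) (Fin d) ℝ) :
    Matrix (Fin (N + 1) × Fin d) (Fin (N + 1) × Fin d) ℝ :=
  Matrix.of fun p q => S ⟨(p.1 : ℕ) + (q.1 : ℕ), by omega⟩ p.2 q.2

/-- The sequence `Y_N, Y_{N-1}, …, Y₁, 0, -Y₁, …, -Y_{N-1}, -Y_N` of length `2N + 1`,
where `Y n` stands for `Y_{n+1}`. -/
def oddExtension {N d : ℕ} (Y : Fin N → Matrix (Fin d) (Fin d) ℝ) :
    Fin (2 * N + 1) → Matrix (Fin d) (Fin d) ℝ := fun k =>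
  if _h₁ : (k : ℕ) < N then Y ⟨N - 1 - (k : ℕ), by omega⟩
  else if _h₂ : N < (k : ℕ) then -Y ⟨(k : ℕ) - N - 1, by omega⟩
  else 0

/-- The tuple `(qqᵀ, qqᵀ cos ω, qqᵀ sin ω, …, qqᵀ cos Nω, qqᵀ sin Nω)`. -/
noncomputable def momentPoint (N : ℕ) (q : EuclideanSpace ℝ (Fin 4)) (ω : ℝ) : Tuple N :=
  (fun n => Real.cos ((n : ℕ) * ω) • Matrix.vecMulVec q q,
   fun n => Real.sin (((n : ℕ) + 1) * ω) • Matrix.vecMulVec q q)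

/-- The set `M_N` of all the tuples `momentPoint N q ω` with `‖q‖ = 1` and `ω ∈ [-π, π)`. -/
def momentSet (N : ℕ) : Set (Tuple N) :=
  {Z | ∃ q : EuclideanSpace ℝ (Fin 4), ∃ ω : ℝ,
    ‖q‖ = 1 ∧ ω ∈ Set.Ico (-Real.pi) Real.pi ∧ Z = momentPoint N q ω}

end TrigMoment

/-! At a moment point the matrix is twice a rank-one square (`blockMoment_momentPoint`), and the
constraints are convex; this gives one inclusion. Conversely, a positive semidefinite matrix is the
Gram matrix of vectors `u (i, a)`. Combining `u (i, a)` with `I • u (N - i, a)` removes the Hankel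
part: the new family `w i a` has Gram blocks `X_{j-i} + I Y_{j-i}` (`exists_stationary`). These
depend only on `j - i`, so the shift `w i ↦ w (i + 1)` extends to a linear isometry `U`, and
diagonalizing `U` writes `X_n + I Y_n` as `∑ μ_k ^ n G_k` with `|μ_k| = 1` and `G_k` Gram matrices.
Symmetry of `X_n`, `Y_n` lets `Re G_k` replace `G_k`. Splitting each `Re G_k` into rank-one terms
and normalizing gives a convex combination, since the trace of `X_0` is 1. -/

open scoped InnerProductSpace ComplexConjugate

/-! ### Spectral theory of finite-dimensional linear isometries. -/

namespace LinearIsometry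

variable {E : Type*} [NormedAddCommGroup E] [InnerProductSpace ℂ E] [FiniteDimensional ℂ E]

/-- Two finite families of vectors with the same Gram matrix differ by a linear isometry. -/
theorem exists_apply_eq_of_inner_eq {κ : Type*} [Fintype κ] (f g : κ → E)
    (h : ∀ i j, ⟪f i, f j⟫_ℂ = ⟪g i, g j⟫_ℂ) : ∃ U : E →ₗᵢ[ℂ] E, ∀ i, U (f i) = g i := by
  classical
  set F : (κ → ℂ) →ₗ[ℂ] E := Fintype.linearCombination ℂ f with hF
  set G : (κ → ℂ) →ₗ[ℂ] E := Fintype.linearCombination ℂ g with hG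
  have hnorm : ∀ c, ‖G c‖ = ‖F c‖ := by
    intro c
    have : ⟪G c, G c⟫_ℂ = ⟪F c, F c⟫_ℂ := by
      simp only [hF, hG, Fintype.linearCombination_apply, sum_inner, inner_sum, inner_smul_left,
        inner_smul_right, h]
    rw [@norm_eq_sqrt_re_inner ℂ, @norm_eq_sqrt_re_inner ℂ, this]
  have hker : LinearMap.ker F ≤ LinearMap.ker G := by
    intro c hc
    rw [LinearMap.mem_ker] at hc ⊢
    rw [← norm_eq_zero, hnorm, hc, norm_zero]
  -- The assignment `F c ↦ G c` is well defined because `ker F ≤ ker G`.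
  let L : LinearMap.range F →ₗ[ℂ] E :=
    ((LinearMap.ker F).liftQ G hker).comp F.quotKerEquivRange.symm.toLinearMap
  have hL : ∀ c, L ⟨F c, c, rfl⟩ = G c := by
    intro c
    have : F.quotKerEquivRange.symm ⟨F c, c, rfl⟩ = (LinearMap.ker F).mkQ c := by
      rw [LinearEquiv.symm_apply_eq]
      rfl
    simp only [L, LinearMap.comp_apply, LinearEquiv.coe_coe, this]
    simp
  let L' : LinearMap.range F →ₗᵢ[ℂ] E := ⟨L, by
    rintro ⟨_, c, rfl⟩
    rw [hL, hnorm]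
    rfl⟩
  refine ⟨L'.extend, fun i => ?_⟩
  have hi : F (Pi.single i 1) = f i := by simp [hF]
  have := L'.extend_apply ⟨F (Pi.single i 1), _, rfl⟩
  rw [show L' _ = _ from hL _] at this
  simpa [hi, hG] using this

/-- A linear isometry of a finite-dimensional inner product space is semisimple. -/
theorem isSemisimple (U : E →ₗᵢ[ℂ] E) : Module.End.IsSemisimple U.toLinearMap := by
  rw [Module.End.isSemisimple_iff]
  intro p hp
  refine ⟨pᗮ, ?_, p.isCompl_orthogonal⟩
  -- By dimension, an invariant subspace is mapped onto itself, so its orthogonal complement is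
  -- invariant too.
  have hmap : p.map U.toLinearMap = p :=
    Submodule.eq_of_le_of_finrank_eq (Submodule.map_le_iff_le_comap.2 hp)
      (Submodule.equivMapOfInjective _ U.injective p).finrank_eq.symm
  intro x hx
  rw [Submodule.mem_comap, Submodule.mem_orthogonal]
  intro y hy
  rw [← hmap] at hy
  obtain ⟨z, hz, rfl⟩ := hy
  simpa using (Submodule.mem_orthogonal _ _).1 hx z hz

omit [FiniteDimensional ℂ E] in
theorem norm_eq_one_of_hasEigenvalue (U : E →ₗᵢ[ℂ] E) {μ : ℂ}
    (hμ : Module.End.HasEigenvalue U.toLinearMap μ) : ‖μ‖ = 1 := by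
  obtain ⟨x, hx⟩ := hμ.exists_hasEigenvector
  have h := U.norm_map x
  rw [show U x = μ • x from hx.apply_eq_smul, norm_smul] at h
  exact mul_right_cancel₀ (norm_ne_zero_iff.2 hx.2) (h.trans (one_mul _).symm)

-- Preserving `⟪x, y⟫` forces `conj μ * ν = 1` unless `⟪x, y⟫ = 0`; on the unit circle this means `μ
-- = ν`.
omit [FiniteDimensional ℂ E] in
theorem orthogonalFamily_eigenspaces (U : E →ₗᵢ[ℂ] E) :
    OrthogonalFamily ℂ
      (fun μ : Module.End.Eigenvalues U.toLinearMap => Module.End.eigenspace U.toLinearMap μ)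
      fun μ => (Module.End.eigenspace U.toLinearMap μ).subtypeₗᵢ := by
  rintro ⟨μ, hμ⟩ ⟨ν, hν⟩ hμν ⟨x, hx⟩ ⟨y, hy⟩
  rw [Module.End.mem_eigenspace_iff] at hx hy
  have hμ1 := U.norm_eq_one_of_hasEigenvalue hμ
  have h := U.inner_map_map x y
  rw [show U x = μ • x from hx, show U y = ν • y from hy, inner_smul_left, inner_smul_right] at h
  by_contra hxy
  have h1 : conj μ * ν = 1 := by
    rw [← mul_assoc] at h
    exact mul_right_cancel₀ hxy (h.trans (one_mul _).symm)
  have h2 : conj μ * μ = 1 := by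
    rw [Complex.conj_mul', hμ1]; simp
  have h3 : conj μ ≠ 0 := left_ne_zero_of_mul_eq_one h2
  exact hμν (Subtype.ext (mul_left_cancel₀ h3 (h2.trans h1.symm)))

/-- The correlations of a finite family of vectors along the orbit of a linear isometry are the
moments of a finitely supported Gram-matrix-valued measure on the unit circle. -/
theorem exists_inner_pow_eq_sum {ι : Type*} (U : E →ₗᵢ[ℂ] E) (v : ι → E) :
    ∃ (κ : Type) (_ : Fintype κ) (μ : κ → ℂ) (w : κ → ι → E), (∀ k, ‖μ k‖ = 1) ∧
      ∀ (n : ℕ) a b, ⟪v a, (U ^ n) (v b)⟫_ℂ = ∑ k, μ k ^ n * ⟪w k a, w k b⟫_ℂ := by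
  classical
  let V : Module.End.Eigenvalues U.toLinearMap → Submodule ℂ E :=
    fun μ => Module.End.eigenspace U.toLinearMap μ
  have hV := U.orthogonalFamily_eigenspaces
  have htop : iSup V = ⊤ := by
    rw [eq_top_iff, ← U.isSemisimple.iSup_eigenspace_eq_top]
    refine iSup_le fun μ => ?_
    by_cases hμ : Module.End.HasEigenvalue U.toLinearMap μ
    · exact le_iSup V ⟨μ, hμ⟩
    · rw [Module.End.hasEigenvalue_iff, not_not] at hμ
      simp [hμ]
  have hsum : ∀ x, ∑ k, (V k).starProjection x = x := fun x =>
    hV.sum_projection_of_mem_iSup x (htop ▸ Submodule.mem_top)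
  have hpow : ∀ (n : ℕ) k x, (U ^ n) ((V k).starProjection x) =
      (k : ℂ) ^ n • (V k).starProjection x := by
    intro n k x
    induction n with
    | zero => simp
    | succ n ih =>
      have : U ((V k).starProjection x) = (k : ℂ) • (V k).starProjection x :=
        Module.End.mem_eigenspace_iff.1 (Submodule.starProjection_apply_mem (V k) x)
      rw [pow_succ', LinearIsometry.coe_mul, Function.comp_apply, ih, map_smul, this, smul_smul, pow_succ]
  refine ⟨Module.End.Eigenvalues U.toLinearMap, inferInstance, fun k => k,
    fun k a => (V k).starProjection (v a), fun k => U.norm_eq_one_of_hasEigenvalue k.2, ?_⟩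
  intro n a b
  conv_lhs => rw [← hsum (v a), ← hsum (v b)]
  simp only [map_sum, hpow, sum_inner, inner_sum, inner_smul_right]
  refine Finset.sum_congr rfl fun k _ => congrArg _ <|
    Finset.sum_eq_single_of_mem k (Finset.mem_univ _) ?_
  intro l _ hl
  have := hV hl ⟨_, Submodule.starProjection_apply_mem (V l) (v a)⟩
    ⟨_, Submodule.starProjection_apply_mem (V k) (v b)⟩
  exact this

end LinearIsometry

/-! ### The truncated matrix trigonometric moment problem. -/

namespace TrigMoment

variable {N d : ℕ}

/-- The even extension to `ℤ` of the cosine moments, by zero outside `[-N, N]`. -/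
def evenMoment (X : Fin (N + 1) → Matrix (Fin d) (Fin d) ℝ) (k : ℤ) : Matrix (Fin d) (Fin d) ℝ :=
  if h : k.natAbs < N + 1 then X ⟨k.natAbs, h⟩ else 0

/-- The odd extension to `ℤ` of the sine moments, by zero outside `[-N, N]`. -/
def oddMoment (Y : Fin N → Matrix (Fin d) (Fin d) ℝ) (k : ℤ) : Matrix (Fin d) (Fin d) ℝ :=
  -- At `k = 0` the subtraction truncates to index 0, and the factor `k.sign = 0` gives the value 0.
  if h : k.natAbs - 1 < N then k.sign • Y ⟨k.natAbs - 1, h⟩ else 0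

theorem evenMoment_neg (X : Fin (N + 1) → Matrix (Fin d) (Fin d) ℝ) (k : ℤ) :
    evenMoment X (-k) = evenMoment X k := by
  simp [evenMoment]

theorem oddMoment_neg (Y : Fin N → Matrix (Fin d) (Fin d) ℝ) (k : ℤ) :
    oddMoment Y (-k) = -oddMoment Y k := by
  unfold oddMoment
  simp only [Int.natAbs_neg, Int.sign_neg]
  split_ifs <;> simp

theorem evenMoment_natCast (X : Fin (N + 1) → Matrix (Fin d) (Fin d) ℝ) (n : Fin (N + 1)) :
    evenMoment X (n : ℕ) = X n := by
  have h : (n : ℤ).natAbs < N + 1 := by omega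
  rw [evenMoment, dif_pos h]
  rfl

theorem oddMoment_natCast_add_one (Y : Fin N → Matrix (Fin d) (Fin d) ℝ) (n : Fin N) :
    oddMoment Y ((n : ℕ) + 1) = Y n := by
  have h : ((n : ℤ) + 1).natAbs - 1 = n := by omega
  have hs : ((n : ℤ) + 1).sign = 1 := Int.sign_eq_one_of_pos (by omega)
  simp [oddMoment, h, hs]

theorem blockToeplitz_apply {X : Fin (N + 1) → Matrix (Fin d) (Fin d) ℝ} (hX : ∀ n, (X n).IsSymm)
    (p q : Fin (N + 1) × Fin d) :
    blockToeplitz X p q = evenMoment X ((q.1 : ℕ) - (p.1 : ℕ) : ℤ) p.2 q.2 := by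
  have hlt : ((q.1 : ℕ) - (p.1 : ℕ) : ℤ).natAbs < N + 1 := by omega
  simp only [blockToeplitz, evenMoment, Matrix.of_apply, dif_pos hlt]
  split_ifs with h
  · congr 3
    omega
  · rw [(hX _).eq]
    congr 3
    omega

theorem oddExtension_apply (Y : Fin N → Matrix (Fin d) (Fin d) ℝ) (k : Fin (2 * N + 1)) :
    oddExtension Y k = oddMoment Y (N - (k : ℕ) : ℤ) := by
  rcases lt_trichotomy (k : ℕ) N with h | h | h
  · have h1 : (N - (k : ℕ) : ℤ).natAbs - 1 < N := by omega
    have h2 : (N - (k : ℕ) : ℤ).sign = 1 := Int.sign_eq_one_of_pos (by omega)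
    have h3 : N - 1 - (k : ℕ) = (N - (k : ℕ) : ℤ).natAbs - 1 := by omega
    simp only [oddExtension, oddMoment, dif_pos h, dif_pos h1, h2, one_smul, h3]
  · have h1 : (N - (k : ℕ) : ℤ).sign = 0 := by rw [h]; simp
    simp [oddExtension, oddMoment, h]
  · have h1 : (N - (k : ℕ) : ℤ).natAbs - 1 < N := by omega
    have h2 : (N - (k : ℕ) : ℤ).sign = -1 := Int.sign_eq_neg_one_of_neg (by omega)
    have h3 : (k : ℕ) - N - 1 = (N - (k : ℕ) : ℤ).natAbs - 1 := by omega
    simp only [oddExtension, oddMoment, dif_neg h.not_gt, dif_pos h, dif_pos h1, h2, neg_smul,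
      one_smul, h3]

/-- The real block matrix whose positivity characterizes trigonometric moments. -/
abbrev blockMoment (X : Fin (N + 1) → Matrix (Fin d) (Fin d) ℝ)
    (Y : Fin N → Matrix (Fin d) (Fin d) ℝ) :
    Matrix (Fin (N + 1) × Fin d) (Fin (N + 1) × Fin d) ℝ :=
  blockToeplitz X + blockHankel (oddExtension Y)

theorem blockMoment_apply {X : Fin (N + 1) → Matrix (Fin d) (Fin d) ℝ} (hX : ∀ n, (X n).IsSymm)
    (Y : Fin N → Matrix (Fin d) (Fin d) ℝ) (p q : Fin (N + 1) × Fin d) :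
    blockMoment X Y p q = evenMoment X ((q.1 : ℕ) - (p.1 : ℕ) : ℤ) p.2 q.2 +
      oddMoment Y (N - (p.1 : ℕ) - (q.1 : ℕ) : ℤ) p.2 q.2 := by
  rw [blockMoment, Matrix.add_apply, blockToeplitz_apply hX, blockHankel, Matrix.of_apply,
    oddExtension_apply]
  simp [sub_sub]

theorem blockMoment_add (X X' : Fin (N + 1) → Matrix (Fin d) (Fin d) ℝ)
    (Y Y' : Fin N → Matrix (Fin d) (Fin d) ℝ) :
    blockMoment (X + X') (Y + Y') = blockMoment X Y + blockMoment X' Y' := by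
  ext p q
  simp only [blockMoment, blockToeplitz, blockHankel, oddExtension, Matrix.add_apply,
    Matrix.of_apply]
  split_ifs <;> simp <;> ring

theorem blockMoment_smul (c : ℝ) (X : Fin (N + 1) → Matrix (Fin d) (Fin d) ℝ)
    (Y : Fin N → Matrix (Fin d) (Fin d) ℝ) :
    blockMoment (c • X) (c • Y) = c • blockMoment X Y := by
  ext p q
  simp only [blockMoment, blockToeplitz, blockHankel, oddExtension, Matrix.add_apply,
    Matrix.smul_apply, Matrix.of_apply]
  split_ifs <;> simp <;> ring

/-- A real Gram matrix, realized in a complex Euclidean space. -/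
theorem exists_inner_eq_of_posSemidef {n : Type*} [Fintype n] {M : Matrix n n ℝ}
    (hM : M.PosSemidef) :
    ∃ (m : ℕ) (u : n → EuclideanSpace ℂ (Fin m)), ∀ i j, ⟪u i, u j⟫_ℂ = (M i j : ℂ) := by
  obtain ⟨m, v, rfl⟩ := Matrix.posSemidef_iff_eq_sum_vecMulVec.1 hM
  refine ⟨m, fun i => WithLp.toLp 2 fun k => (v k i : ℂ), fun i j => ?_⟩
  simp [PiLp.inner_apply, Matrix.sum_apply, Matrix.vecMulVec_apply, mul_comm]

/-- A positive semidefinite real block moment matrix is unitarily equivalent to the Gram matrix of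
a stationary family. -/
theorem exists_stationary {X : Fin (N + 1) → Matrix (Fin d) (Fin d) ℝ} (hX : ∀ n, (X n).IsSymm)
    (Y : Fin N → Matrix (Fin d) (Fin d) ℝ) (h : (blockMoment X Y).PosSemidef) :
    ∃ (m : ℕ) (w : Fin (N + 1) → Fin d → EuclideanSpace ℂ (Fin m)), ∀ i j a b,
      ⟪w i a, w j b⟫_ℂ = (evenMoment X ((j : ℕ) - (i : ℕ) : ℤ) a b : ℂ) +
        Complex.I * (oddMoment Y ((j : ℕ) - (i : ℕ) : ℤ) a b : ℂ) := by
  obtain ⟨m, u, hu⟩ := exists_inner_eq_of_posSemidef h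
  set r : ℂ := (((√2)⁻¹ : ℝ) : ℂ) with hr
  have hrr : conj r * r = 1 / 2 := by
    rw [hr, Complex.conj_ofReal, ← Complex.ofReal_mul, ← mul_inv, Real.mul_self_sqrt (by norm_num)]
    simp
  -- Reversing both indices flips the sign of the Hankel part, so it cancels in the diagonal terms;
  -- in the cross terms the Toeplitz parts cancel and `Y_{j-i}` survives.
  refine ⟨m, fun i a => r • (u (i, a) + Complex.I • u (i.rev, a)), fun i j a b => ?_⟩
  have hi : ((i.rev : ℕ) : ℤ) = N - (i : ℕ) := by rw [Fin.val_rev]; omega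
  have hj : ((j.rev : ℕ) : ℤ) = N - (j : ℕ) := by rw [Fin.val_rev]; omega
  have e1 : (N - (j : ℕ) - (N - (i : ℕ)) : ℤ) = -((j : ℕ) - (i : ℕ)) := by ring
  have e2 : (N - (N - (i : ℕ)) - (N - (j : ℕ)) : ℤ) = -(N - (i : ℕ) - (j : ℕ)) := by ring
  have e3 : (N - (j : ℕ) - (i : ℕ) : ℤ) = N - (i : ℕ) - (j : ℕ) := by ring
  have e4 : ((j : ℕ) - (N - (i : ℕ)) : ℤ) = -(N - (i : ℕ) - (j : ℕ)) := by ring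
  have e5 : (N - (i : ℕ) - (N - (j : ℕ)) : ℤ) = (j : ℕ) - (i : ℕ) := by ring
  have e6 : (N - (N - (i : ℕ)) - (j : ℕ) : ℤ) = -((j : ℕ) - (i : ℕ)) := by ring
  simp only [inner_smul_left, inner_smul_right, inner_add_left, inner_add_right, hu,
    blockMoment_apply hX, hi, hj, e1, e2, e3, e4, e5, e6, evenMoment_neg, oddMoment_neg,
    Complex.conj_I, Matrix.neg_apply]
  generalize evenMoment X ((j : ℕ) - (i : ℕ) : ℤ) a b = A
  generalize evenMoment X (N - (i : ℕ) - (j : ℕ) : ℤ) a b = B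
  generalize oddMoment Y ((j : ℕ) - (i : ℕ) : ℤ) a b = C
  generalize oddMoment Y (N - (i : ℕ) - (j : ℕ) : ℤ) a b = D
  push_cast
  linear_combination (A + D + 2 * Complex.I * C - Complex.I ^ 2 * (A - D) : ℂ) * hrr -
    (A - D : ℂ) / 2 * Complex.I_sq

/-- Truncated matrix trigonometric moment problem for symmetric moments. -/
theorem exists_eq_sum_of_posSemidef {X : Fin (N + 1) → Matrix (Fin d) (Fin d) ℝ}
    {Y : Fin N → Matrix (Fin d) (Fin d) ℝ} (hX : ∀ n, (X n).IsSymm) (hY : ∀ n, (Y n).IsSymm)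
    (h : (blockMoment X Y).PosSemidef) :
    ∃ (κ : Type) (_ : Fintype κ) (ω : κ → ℝ) (P : κ → Matrix (Fin d) (Fin d) ℝ),
      (∀ k, ω k ∈ Set.Ico (-Real.pi) Real.pi) ∧ (∀ k, (P k).PosSemidef) ∧
      (∀ n, X n = ∑ k, Real.cos ((n : ℕ) * ω k) • P k) ∧
      ∀ n, Y n = ∑ k, Real.sin (((n : ℕ) + 1) * ω k) • P k := by
  obtain ⟨m, w, hw⟩ := exists_stationary hX Y h
  obtain ⟨U, hU⟩ := LinearIsometry.exists_apply_eq_of_inner_eq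
    (fun p : Fin N × Fin d => w p.1.castSucc p.2) (fun p => w p.1.succ p.2) (by
      intro p q
      simp [hw])
  have hUpow : ∀ (n : ℕ) (hn : n < N + 1) a, (U ^ n) (w 0 a) = w ⟨n, hn⟩ a := by
    intro n
    induction n with
    | zero => intro _ a; simp
    | succ n ih =>
      intro hn a
      rw [pow_succ', LinearIsometry.coe_mul, Function.comp_apply, ih (by omega)]
      exact hU (⟨n, by omega⟩, a)
  obtain ⟨κ, _, μ, v, hμ, hv⟩ := U.exists_inner_pow_eq_sum (w 0)
  have hω : ∀ k, ∃ ω ∈ Set.Ico (-Real.pi) Real.pi, Complex.exp (ω * Complex.I) = μ k := by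
    intro k
    have he : Complex.exp ((μ k).arg * Complex.I) = μ k := by
      simpa [hμ k] using Complex.norm_mul_exp_arg_mul_I (μ k)
    -- `arg` takes values in `(-π, π]`, so the value `π` is traded for `-π`.
    rcases (Complex.arg_le_pi (μ k)).lt_or_eq with hlt | heq
    · exact ⟨_, ⟨(Complex.neg_pi_lt_arg _).le, hlt⟩, he⟩
    · refine ⟨-Real.pi, ⟨le_rfl, by linarith [Real.pi_pos]⟩, ?_⟩
      rw [← he, heq, Complex.exp_pi_mul_I]
      push_cast
      rw [neg_mul, Complex.exp_neg, Complex.exp_pi_mul_I]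
      norm_num
  choose ω hωI hωμ using hω
  have key : ∀ (n : ℕ) (hn : n < N + 1) a b,
      (evenMoment X n a b : ℂ) + Complex.I * (oddMoment Y n a b : ℂ) =
        ∑ k, ((Real.cos (n * ω k) : ℂ) + Real.sin (n * ω k) * Complex.I) *
          ⟪v k a, v k b⟫_ℂ := by
    intro n hn a b
    have h1 := hw 0 ⟨n, hn⟩ a b
    rw [← hUpow n hn b, hv] at h1
    simp only [Fin.val_zero, Nat.cast_zero, sub_zero] at h1
    rw [← h1]
    refine Finset.sum_congr rfl fun k _ => ?_
    rw [← hωμ, ← Complex.exp_nat_mul, ← mul_assoc, Complex.exp_mul_I]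
    push_cast
    rfl
  have hre : ∀ k a b, (⟪v k b, v k a⟫_ℂ).re = (⟪v k a, v k b⟫_ℂ).re := by
    intro k a b
    rw [← inner_conj_symm, Complex.conj_re]
  have him : ∀ k a b, (⟪v k b, v k a⟫_ℂ).im = -(⟪v k a, v k b⟫_ℂ).im := by
    intro k a b
    rw [← inner_conj_symm, Complex.conj_im]
  -- Averaging the `(a, b)` and `(b, a)` entries removes the antisymmetric imaginary parts of the
  -- Gram matrices.
  have hreal : ∀ (n : ℕ) (hn : n < N + 1) a b, evenMoment X n a b = evenMoment X n b a →
      evenMoment X n a b = ∑ k, Real.cos (n * ω k) * (⟪v k a, v k b⟫_ℂ).re := by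
    intro n hn a b hs
    have h1 := congrArg Complex.re (key n hn a b)
    have h2 := congrArg Complex.re (key n hn b a)
    simp only [Complex.re_sum, Complex.add_re, Complex.mul_re, Complex.add_im, Complex.mul_im,
      Complex.ofReal_re, Complex.ofReal_im, Complex.I_re, Complex.I_im, hre _ a b, him _ a b,
      Finset.sum_sub_distrib, mul_neg, Finset.sum_neg_distrib, zero_mul, mul_zero, mul_one,
      zero_add, add_zero, sub_zero] at h1 h2
    linarith
  have himag : ∀ (n : ℕ) (hn : n < N + 1) a b, oddMoment Y n a b = oddMoment Y n b a →
      oddMoment Y n a b = ∑ k, Real.sin (n * ω k) * (⟪v k a, v k b⟫_ℂ).re := by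
    intro n hn a b hs
    have h1 := congrArg Complex.im (key n hn a b)
    have h2 := congrArg Complex.im (key n hn b a)
    simp only [Complex.im_sum, Complex.add_re, Complex.mul_re, Complex.add_im, Complex.mul_im,
      Complex.ofReal_re, Complex.ofReal_im, Complex.I_re, Complex.I_im, hre _ a b, him _ a b,
      Finset.sum_add_distrib, mul_neg, Finset.sum_neg_distrib, mul_zero, mul_one,
      one_mul, zero_add, add_zero, sub_zero] at h1 h2
    linarith
  refine ⟨κ, inferInstance, ω, fun k => Matrix.of fun a b => (⟪v k a, v k b⟫_ℂ).re, hωI, ?_, ?_, ?_⟩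
  · intro k
    exact @Matrix.posSemidef_gram _ _ ℝ _ _ (InnerProductSpace.rclikeToReal ℂ _) _ (v k)
  · intro n
    ext a b
    have := hreal n n.2 a b (by rw [evenMoment_natCast]; exact (hX n).apply b a)
    rw [evenMoment_natCast] at this
    simpa [Matrix.sum_apply] using this
  · intro n
    ext a b
    have := himag ((n : ℕ) + 1) (by omega) a b (by
      push_cast; rw [oddMoment_natCast_add_one]; exact (hY n).apply b a)
    push_cast at this
    rw [oddMoment_natCast_add_one] at this
    simpa [Matrix.sum_apply] using this

end TrigMoment

/-! ### Moment points and the convex hull. -/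

namespace TrigMoment

variable {N : ℕ}

theorem evenMoment_cos {d : ℕ} (Q : Matrix (Fin d) (Fin d) ℝ) (ω : ℝ) {k : ℤ}
    (hk : k.natAbs < N + 1) :
    evenMoment (fun n : Fin (N + 1) => Real.cos ((n : ℕ) * ω) • Q) k = Real.cos (k * ω) • Q := by
  obtain ⟨n, rfl | rfl⟩ := k.eq_nat_or_neg
  · simp only [Int.natAbs_natCast] at hk
    exact evenMoment_natCast _ ⟨n, hk⟩
  · simp only [Int.natAbs_neg, Int.natAbs_natCast] at hk
    rw [evenMoment_neg]
    push_cast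
    rw [neg_mul, Real.cos_neg]
    exact evenMoment_natCast _ ⟨n, hk⟩

theorem oddMoment_sin {d : ℕ} (Q : Matrix (Fin d) (Fin d) ℝ) (ω : ℝ) {k : ℤ}
    (hk : k.natAbs < N + 1) :
    oddMoment (fun n : Fin N => Real.sin (((n : ℕ) + 1) * ω) • Q) k = Real.sin (k * ω) • Q := by
  have hnat : ∀ n : ℕ, n < N + 1 →
      oddMoment (fun n : Fin N => Real.sin (((n : ℕ) + 1) * ω) • Q) (n : ℤ) =
        Real.sin (n * ω) • Q := by
    rintro (_ | n) hn
    · simp [oddMoment]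
    · push_cast
      exact oddMoment_natCast_add_one (N := N) _ ⟨n, by omega⟩
  obtain ⟨n, rfl | rfl⟩ := k.eq_nat_or_neg
  · exact hnat n (by simpa using hk)
  · rw [oddMoment_neg, hnat n (by simpa using hk)]
    push_cast
    rw [neg_mul, Real.sin_neg, neg_smul]

theorem isSymm_vecMulVec_self {n R : Type*} [CommMagma R] (q : n → R) :
    (Matrix.vecMulVec q q).IsSymm := by
  ext i j
  simp [Matrix.vecMulVec_apply, mul_comm]

/-- Product-to-sum: the phase cancels in the difference of angles (Toeplitz part), while twice the
phase, `π / 2 - N * ω`, turns the cosine of the sum into the sine of the Hankel part. -/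
theorem blockMoment_momentPoint (q : EuclideanSpace ℝ (Fin 4)) (ω : ℝ) :
    blockMoment (momentPoint N q ω).1 (momentPoint N q ω).2 =
      (2 : ℝ) • Matrix.vecMulVec
        (fun p : Fin (N + 1) × Fin 4 =>
          Real.cos ((p.1 : ℕ) * ω + (Real.pi / 4 - N * ω / 2)) * q p.2)
        (fun p => Real.cos ((p.1 : ℕ) * ω + (Real.pi / 4 - N * ω / 2)) * q p.2) := by
  ext ⟨i, a⟩ ⟨j, b⟩
  have hsymm : ∀ n, ((momentPoint N q ω).1 n).IsSymm := fun n =>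
    (isSymm_vecMulVec_self _).smul _
  rw [blockMoment_apply hsymm]
  simp only [momentPoint]
  rw [evenMoment_cos _ _ (by omega), oddMoment_sin _ _ (by omega)]
  simp only [Matrix.smul_apply, Matrix.vecMulVec_apply, smul_eq_mul]
  have h := Real.two_mul_cos_mul_cos ((i : ℕ) * ω + (Real.pi / 4 - N * ω / 2))
    ((j : ℕ) * ω + (Real.pi / 4 - N * ω / 2))
  have h1 : Real.cos ((i : ℕ) * ω + (Real.pi / 4 - N * ω / 2) -
      ((j : ℕ) * ω + (Real.pi / 4 - N * ω / 2))) = Real.cos (((j : ℕ) - (i : ℕ)) * ω) := by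
    rw [← Real.cos_neg]
    ring_nf
  have h2 : Real.cos ((i : ℕ) * ω + (Real.pi / 4 - N * ω / 2) +
      ((j : ℕ) * ω + (Real.pi / 4 - N * ω / 2))) =
      Real.sin ((N - (i : ℕ) - (j : ℕ)) * ω) := by
    rw [← Real.cos_pi_div_two_sub]
    ring_nf
  rw [h1, h2] at h
  push_cast
  linear_combination (-q a * q b) * h

theorem trace_vecMulVec_self (q : EuclideanSpace ℝ (Fin 4)) :
    (Matrix.vecMulVec q q).trace = ‖q‖ ^ 2 := by
  simp [EuclideanSpace.real_norm_sq_eq, Matrix.trace, Matrix.vecMulVec_apply, ← sq]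

theorem momentPoint_smul (c : ℝ) (q : EuclideanSpace ℝ (Fin 4)) (ω : ℝ) :
    momentPoint N (c • q) ω = c ^ 2 • momentPoint N q ω := by
  ext n a b <;> simp [momentPoint, Matrix.vecMulVec_apply] <;> ring

theorem exists_mem_momentSet (q : EuclideanSpace ℝ (Fin 4)) {ω : ℝ}
    (hω : ω ∈ Set.Ico (-Real.pi) Real.pi) :
    ∃ Z ∈ momentSet N, momentPoint N q ω = ‖q‖ ^ 2 • Z := by
  obtain ⟨e, he, hq⟩ : ∃ e : EuclideanSpace ℝ (Fin 4), ‖e‖ = 1 ∧ q = ‖q‖ • e := by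
    by_cases hq : q = 0
    -- For `q = 0` the weight is 0, so any unit vector serves.
    · exact ⟨EuclideanSpace.single 0 1, by simp, by simp [hq]⟩
    · have hn := norm_ne_zero_iff.2 hq
      exact ⟨‖q‖⁻¹ • q, by rw [norm_smul, norm_inv, norm_norm, inv_mul_cancel₀ hn],
        by rw [smul_smul, mul_inv_cancel₀ hn, one_smul]⟩
  exact ⟨momentPoint N e ω, ⟨e, ω, he, hω, rfl⟩, by rw [← momentPoint_smul, ← hq]⟩

/-- The tuples of symmetric matrices cut out by the trace and semidefiniteness conditions. -/
def momentSpectrahedron (N : ℕ) : Set (Tuple N) :=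
  {Z | (∀ n, (Z.1 n).IsSymm) ∧ (∀ n, (Z.2 n).IsSymm) ∧ (Z.1 0).trace = 1 ∧
    (blockMoment Z.1 Z.2).PosSemidef}

theorem convex_momentSpectrahedron : Convex ℝ (momentSpectrahedron N) := by
  rintro Z ⟨hX, hY, ht, hp⟩ W ⟨hX', hY', ht', hp'⟩ a b ha hb hab
  refine ⟨fun n => ((hX n).smul a).add ((hX' n).smul b),
    fun n => ((hY n).smul a).add ((hY' n).smul b), ?_, ?_⟩
  · simp [ht, ht', hab]
  · simp only [Prod.fst_add, Prod.snd_add, Prod.smul_fst, Prod.smul_snd, blockMoment_add,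
      blockMoment_smul]
    exact (hp.smul ha).add (hp'.smul hb)

theorem momentSet_subset_momentSpectrahedron : momentSet N ⊆ momentSpectrahedron N := by
  rintro _ ⟨q, ω, hq, -, rfl⟩
  refine ⟨fun n => (isSymm_vecMulVec_self _).smul _, fun n => (isSymm_vecMulVec_self _).smul _,
    ?_, ?_⟩
  · change (Real.cos ((0 : ℕ) * ω) • Matrix.vecMulVec q q).trace = 1
    rw [Matrix.trace_smul, trace_vecMulVec_self, hq]
    simp
  · rw [blockMoment_momentPoint]
    exact (Matrix.posSemidef_vecMulVec_self_star (R := ℝ) _).smul zero_le_two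

theorem momentSpectrahedron_subset_convexHull :
    momentSpectrahedron N ⊆ convexHull ℝ (momentSet N) := by
  rintro ⟨X, Y⟩ ⟨hX, hY, ht, hp⟩
  obtain ⟨κ, _, ω, P, hω, hP, hXP, hYP⟩ := exists_eq_sum_of_posSemidef hX hY hp
  choose m r hr using fun k => Matrix.posSemidef_iff_eq_sum_vecMulVec.1 (hP k)
  let q : (Σ k, Fin (m k)) → EuclideanSpace ℝ (Fin 4) := fun s => WithLp.toLp 2 (r s.1 s.2)
  choose Z hZ hqZ using fun s : Σ k, Fin (m k) => exists_mem_momentSet (N := N) (q s) (hω s.1)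
  have hsum : (X, Y) = ∑ s, ‖q s‖ ^ 2 • Z s := by
    simp only [← hqZ, momentPoint, q, Fintype.sum_sigma]
    refine Prod.ext (funext fun n => ?_) (funext fun n => ?_)
    · simp only [Prod.fst_sum, Finset.sum_apply]
      exact (hXP n).trans <| Finset.sum_congr rfl fun k _ => by rw [hr k, Finset.smul_sum]; rfl
    · simp only [Prod.snd_sum, Finset.sum_apply]
      exact (hYP n).trans <| Finset.sum_congr rfl fun k _ => by rw [hr k, Finset.smul_sum]; rfl
  -- The trace of the zeroth component is 1 for `(X, Y)` and for every `Z s`.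
  have hone : ∑ s, ‖q s‖ ^ 2 = 1 := by
    have htr : (((X, Y) : Tuple N).1 0).trace = 1 := ht
    rw [hsum] at htr
    simpa [Prod.fst_sum, Finset.sum_apply, Matrix.trace_sum, Matrix.trace_smul,
      fun s => (momentSet_subset_momentSpectrahedron (hZ s)).2.2.1] using htr
  rw [hsum]
  exact (convex_convexHull ℝ _).sum_mem (fun s _ => by positivity) hone
    fun s _ => subset_convexHull ℝ _ (hZ s)

end TrigMoment

theorem proposition1 (N : ℕ) :
    convexHull ℝ (TrigMoment.momentSet N) =
      {Z : TrigMoment.Tuple N |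
        (∀ n, (Z.1 n).IsSymm) ∧ (∀ n, (Z.2 n).IsSymm) ∧
        (Z.1 0).trace = 1 ∧
        (TrigMoment.blockToeplitz Z.1 +
          TrigMoment.blockHankel (TrigMoment.oddExtension Z.2)).PosSemidef} :=
  (convexHull_min TrigMoment.momentSet_subset_momentSpectrahedron
    TrigMoment.convex_momentSpectrahedron).antisymm
    TrigMoment.momentSpectrahedron_subset_convexHull
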